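/- For a finite group $G$ and a symmetric subset $T=T^{-1}\subseteq G$, let $\operatorname{Cay}(G,T)$ be the Cayley graph with vertex set $G$ and edges $(g,gs)$ for all $g\in G$, $s\in T$ (with a loop at every vertex if $1\in T$). Write $\lambda_1\ge\lambda_2\ge\cdots$ for the eigenvalues of the adjacency matrix of a graph, listed in descending order with multiplicity. The spectral gap of the graph is $\lambda_1-\lambda_2$, and its second eigenvalue multiplicity is the number of times $\lambda_2$ appears in this list. **Theorem 2.1.** Let $\Gamma$ be a finite group, let $S=S^{-1}$ be a symmetric subset of $\Gamma$, and let $\Pi$ be the subgroup of $\Gamma$ generated by $S$. Suppose that $\operatorname{Cay}(\Pi,S)$ has spectral gap at least $4$, and that the set of double cosets $\Pi\backslash\Gamma/\Pi=\{\Pi g\Pi : g\in\Gamma\}$ has exactly two elements. Let $t\in\Gamma$ with $t\notin\Pi$ and $t\ne t^{-1}$. Then $\operatorname{Cay}(\Gamma,S\cup\{t,t^{-1}\})$ has second eigenvalue multiplicity at least $|\Gamma|/|\Pi|-1$. -/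

import Mathlib

open scoped Pointwise

noncomputable section

/-- The eigenvalues `λ₁ ≥ λ₂ ≥ ⋯` of a real square matrix, in descending order and repeated
according to multiplicity as roots of the characteristic polynomial. For a symmetric `n × n`
matrix this list has exactly `n` entries. -/
def eigenvalueList {V : Type*} [Finite V] (A : Matrix V V ℝ) : List ℝ :=
  letI := Fintype.ofFinite V
  letI := Classical.decEq V
  A.charpoly.roots.sort (· ≥ ·)

/-- The largest eigenvalue `λ₁`. -/
def firstEigenvalue {V : Type*} [Finite V] (A : Matrix V V ℝ) : ℝ :=
  (eigenvalueList A).getD 0 0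

/-- The second eigenvalue `λ₂`: the second entry of the descending list
(meaningful when there are at least two vertices). -/
def secondEigenvalue {V : Type*} [Finite V] (A : Matrix V V ℝ) : ℝ :=
  (eigenvalueList A).getD 1 0

/-- The spectral gap `λ₁ - λ₂`, not normalized by the degree. -/
def spectralGap {V : Type*} [Finite V] (A : Matrix V V ℝ) : ℝ :=
  firstEigenvalue A - secondEigenvalue A

/-- The number of times that `λ₂` occurs in the list of eigenvalues. -/
def secondEigenvalueMultiplicity {V : Type*} [Finite V] (A : Matrix V V ℝ) : ℕ :=
  (eigenvalueList A).count (secondEigenvalue A)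

open Classical in
/-- The adjacency matrix of the Cayley graph `Cay(G, S)`, which has vertex set `G` and the edges
`(g, g * s)` for `g ∈ G` and `s ∈ S`. If `1 ∈ S`, there is a loop at each vertex, recorded by a `1`
on the diagonal. -/
def cayleyAdjMatrix {G : Type*} [Group G] (S : Set G) : Matrix G G ℝ :=
  Matrix.of fun g h => if g⁻¹ * h ∈ S then 1 else 0

/-- If `S = S⁻¹` does not contain `1`, this is the adjacency matrix of Mathlib's Cayley graph. -/
theorem cayleyAdjMatrix_eq_adjMatrix {G : Type*} [Group G] {S : Set G} (hS : S⁻¹ = S)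
    (h1 : (1 : G) ∉ S) [DecidableRel (SimpleGraph.mulCayley S).Adj] :
    cayleyAdjMatrix S = (SimpleGraph.mulCayley S).adjMatrix ℝ := by
  ext g h
  have key : (SimpleGraph.mulCayley S).Adj g h ↔ g⁻¹ * h ∈ S := by
    rw [SimpleGraph.mulCayley_adj]
    constructor
    · rintro ⟨-, h' | h'⟩
      · exact h'
      · rw [← hS]
        simpa using h'
    · intro h'
      refine ⟨?_, Or.inl h'⟩
      rintro rfl
      exact h1 (by simpa using h')
  by_cases h' : g⁻¹ * h ∈ S
  · simp [cayleyAdjMatrix, SimpleGraph.adjMatrix_apply, h', key.2 h']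
  · simp [cayleyAdjMatrix, SimpleGraph.adjMatrix_apply, h', mt key.1 h']

/-- The adjacency matrix of `Cay(G, S)` with `S = S⁻¹` is symmetric. -/
theorem cayleyAdjMatrix_isSymm {G : Type*} [Group G] {S : Set G} (hS : S⁻¹ = S) :
    (cayleyAdjMatrix S).IsSymm := by
  ext g h
  have key : h⁻¹ * g ∈ S ↔ g⁻¹ * h ∈ S := by
    rw [← Set.inv_mem_inv, hS]
    simp
  by_cases h' : g⁻¹ * h ∈ S
  · simp [cayleyAdjMatrix, h', key.2 h']
  · simp [cayleyAdjMatrix, h', mt key.1 h']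

end

/-!
Put `A = Cay(Γ, S ∪ U)` with `U = {t, t⁻¹}`, and split functions on `Γ` along the left cosets of
`P`. A function that is constant on the cosets is an eigenfunction of `Cay(Γ, S)` for `|S|`, so its
Rayleigh quotient for `A` is at least `|S| - |U|`. A function with sum zero on every coset has
Rayleigh quotient at most `λ₂(Cay(P, S))` for `Cay(Γ, S)`; as the gap is at least `2 |U|`, its
Rayleigh quotient for `A` is at most `|S| - |U|`. Hence some `λ₂`-eigenfunction of `A` with total
sum zero has a nonzero coset sum.

The `λ₂`-eigenfunctions with total sum zero are stable under left translation, so their coset sums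
form a nonzero subrepresentation of the sum-zero functions on `Γ ⧸ P`. Two double cosets make
`Γ` act 2-transitively on `Γ ⧸ P`, and the sum-zero functions are then irreducible, of dimension
`|Γ| / |P| - 1`.
-/

open Matrix Module

section SymmetricMatrix

variable {V : Type*} {A : Matrix V V ℝ}

theorem firstEigenvalue_eq_of_eigenvalueList_eq_ofFn [Finite V] {n : ℕ} {μ : Fin n → ℝ}
    (hμ : eigenvalueList A = List.ofFn μ) (hn : 0 < n) : firstEigenvalue A = μ ⟨0, hn⟩ := by
  simp [firstEigenvalue, hμ, hn]

theorem secondEigenvalue_eq_of_eigenvalueList_eq_ofFn [Finite V] {n : ℕ} {μ : Fin n → ℝ}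
    (hμ : eigenvalueList A = List.ofFn μ) (hn : 1 < n) : secondEigenvalue A = μ ⟨1, hn⟩ := by
  simp [secondEigenvalue, hμ, hn]

variable [Fintype V]

theorem dotProduct_self_nonneg (f : V → ℝ) : 0 ≤ f ⬝ᵥ f := by
  simpa using dotProduct_self_star_nonneg f

theorem dotProduct_self_pos {f : V → ℝ} (hf : f ≠ 0) : 0 < f ⬝ᵥ f := by
  simpa using dotProduct_self_star_pos_iff.2 hf

theorem dotProduct_mulVec_comm_of_isSymm (hA : A.IsSymm) (x y : V → ℝ) :
    x ⬝ᵥ A *ᵥ y = y ⬝ᵥ A *ᵥ x := by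
  rw [dotProduct_mulVec, ← mulVec_transpose, hA.eq, dotProduct_comm]

theorem exists_sorted_orthonormalBasis_of_isSymm (hA : A.IsSymm) :
    ∃ (μ : Fin (Fintype.card V) → ℝ)
      (b : OrthonormalBasis (Fin (Fintype.card V)) ℝ (EuclideanSpace ℝ V)),
      Antitone μ ∧ eigenvalueList A = List.ofFn μ ∧ ∀ k, A *ᵥ b k = μ k • ⇑(b k) := by
  classical
  have hH : A.IsHermitian := hA
  refine ⟨hH.eigenvalues₀, hH.eigenvectorBasis.reindex
    (Fintype.equivOfCardEq (Fintype.card_fin _)).symm, hH.eigenvalues₀_antitone, ?_, fun k => ?_⟩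
  · rw [← hH.sort_roots_charpoly_eq_eigenvalues₀]
    simp only [eigenvalueList, RCLike.re_to_real, Multiset.map_id']
    congr!
  · simpa [IsHermitian.eigenvalues] using
      hH.mulVec_eigenvectorBasis (Fintype.equivOfCardEq (Fintype.card_fin _) k)

theorem dotProduct_orthonormalBasis_eq_ite {ι : Type*} [Fintype ι] [DecidableEq ι]
    (b : OrthonormalBasis ι ℝ (EuclideanSpace ℝ V)) (i j : ι) :
    ⇑(b i) ⬝ᵥ ⇑(b j) = if i = j then 1 else 0 := by
  rw [← b.inner_eq_ite, EuclideanSpace.inner_eq_star_dotProduct, star_trivial, dotProduct_comm]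

theorem dotProduct_mulVec_eq_sum {ι : Type*} [Fintype ι]
    (b : OrthonormalBasis ι ℝ (EuclideanSpace ℝ V)) {μ : ι → ℝ}
    (hb : ∀ i, A *ᵥ b i = μ i • ⇑(b i)) (f : V → ℝ) :
    f ⬝ᵥ A *ᵥ f = ∑ i, μ i * (⇑(b i) ⬝ᵥ f) ^ 2 := by
  have hf : f = ∑ i, (⇑(b i) ⬝ᵥ f) • ⇑(b i) := by
    simpa [EuclideanSpace.inner_eq_star_dotProduct, dotProduct_comm] using
      (congrArg WithLp.ofLp (b.sum_repr' (WithLp.toLp 2 f))).symm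
  have hAf : A *ᵥ f = ∑ i, (μ i * (⇑(b i) ⬝ᵥ f)) • ⇑(b i) := by
    conv_lhs => rw [hf]
    simp only [mulVec_sum, mulVec_smul, hb, smul_smul, mul_comm]
  rw [hAf, dotProduct_sum]
  refine Finset.sum_congr rfl fun i _ => ?_
  rw [dotProduct_smul, smul_eq_mul, dotProduct_comm f]
  ring

theorem dotProduct_self_eq_sum {ι : Type*} [Fintype ι]
    (b : OrthonormalBasis ι ℝ (EuclideanSpace ℝ V)) (f : V → ℝ) :
    f ⬝ᵥ f = ∑ i, (⇑(b i) ⬝ᵥ f) ^ 2 := by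
  classical
  simpa using dotProduct_mulVec_eq_sum (A := 1) (μ := 1) b (fun i => by simp) f

theorem exists_firstEigenvector [Nonempty V] (hA : A.IsSymm) :
    ∃ e : V → ℝ, e ≠ 0 ∧ A *ᵥ e = firstEigenvalue A • e ∧
      ∀ f, e ⬝ᵥ f = 0 → f ⬝ᵥ A *ᵥ f ≤ secondEigenvalue A * (f ⬝ᵥ f) := by
  obtain ⟨μ, b, hμ, hlist, hb⟩ := exists_sorted_orthonormalBasis_of_isSymm hA
  have hcard : 0 < Fintype.card V := Fintype.card_pos
  refine ⟨b ⟨0, hcard⟩, ?_, ?_, fun f hf => ?_⟩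
  · simpa using b.toBasis.ne_zero ⟨0, hcard⟩
  · rw [hb, firstEigenvalue_eq_of_eigenvalueList_eq_ofFn hlist hcard]
  · rw [dotProduct_mulVec_eq_sum b hb, dotProduct_self_eq_sum b, Finset.mul_sum]
    refine Finset.sum_le_sum fun k _ => ?_
    obtain rfl | hk := eq_or_ne k ⟨0, hcard⟩
    · rw [hf, zero_pow two_ne_zero, mul_zero, mul_zero]
    · have hk : 1 ≤ k.val := Nat.one_le_iff_ne_zero.2 fun h => hk (Fin.ext h)
      rw [secondEigenvalue_eq_of_eigenvalueList_eq_ofFn hlist (hk.trans_lt k.isLt)]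
      gcongr
      exact hμ hk

theorem exists_firstEigenvector_secondEigenvector [Nontrivial V] (hA : A.IsSymm) :
    ∃ e₀ e₁ : V → ℝ, e₀ ⬝ᵥ e₀ = 1 ∧ e₁ ⬝ᵥ e₁ = 1 ∧ e₀ ⬝ᵥ e₁ = 0 ∧
      A *ᵥ e₀ = firstEigenvalue A • e₀ ∧ A *ᵥ e₁ = secondEigenvalue A • e₁ ∧
      secondEigenvalue A ≤ firstEigenvalue A := by
  obtain ⟨μ, b, hμ, hlist, hb⟩ := exists_sorted_orthonormalBasis_of_isSymm hA
  have hcard : 1 < Fintype.card V := Fintype.one_lt_card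
  rw [firstEigenvalue_eq_of_eigenvalueList_eq_ofFn hlist (by omega),
    secondEigenvalue_eq_of_eigenvalueList_eq_ofFn hlist hcard]
  refine ⟨b ⟨0, by omega⟩, b ⟨1, hcard⟩, ?_, ?_, ?_, hb _, hb _, hμ (by simp)⟩ <;>
    simp [dotProduct_orthonormalBasis_eq_ite]

theorem exists_dotProduct_eq_zero_secondEigenvalue_mul_le [Nontrivial V] (hA : A.IsSymm)
    (u : V → ℝ) :
    ∃ f, f ≠ 0 ∧ u ⬝ᵥ f = 0 ∧ secondEigenvalue A * (f ⬝ᵥ f) ≤ f ⬝ᵥ A *ᵥ f := by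
  obtain ⟨e₀, e₁, h₀, h₁, h₀₁, hAe₀, hAe₁, hle⟩ := exists_firstEigenvector_secondEigenvector hA
  obtain hu | hu := eq_or_ne (u ⬝ᵥ e₀) 0
  · exact ⟨e₀, by rintro rfl; simp at h₀, hu, by simpa [hAe₀, h₀] using hle⟩
  · have h₁₀ : e₁ ⬝ᵥ e₀ = 0 := dotProduct_comm e₀ e₁ ▸ h₀₁
    refine ⟨(u ⬝ᵥ e₁) • e₀ - (u ⬝ᵥ e₀) • e₁, fun h => hu ?_, ?_, ?_⟩
    · simpa [h₁, h₁₀] using congrArg (e₁ ⬝ᵥ ·) h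
    · simp [mul_comm]
    · simp only [mulVec_sub, mulVec_smul, hAe₀, hAe₁, sub_dotProduct, dotProduct_sub,
        smul_dotProduct, dotProduct_smul, smul_eq_mul, h₀, h₁, h₀₁, h₁₀]
      nlinarith [mul_le_mul_of_nonneg_left hle (sq_nonneg (u ⬝ᵥ e₁))]

theorem firstEigenvalue_le_of_dotProduct_mulVec_le [Nonempty V] (hA : A.IsSymm) {d : ℝ}
    (hd : ∀ f, f ⬝ᵥ A *ᵥ f ≤ d * (f ⬝ᵥ f)) : firstEigenvalue A ≤ d := by
  obtain ⟨e, he, hAe, -⟩ := exists_firstEigenvector hA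
  have h := hd e
  rw [hAe, dotProduct_smul, smul_eq_mul] at h
  exact le_of_mul_le_mul_right h (dotProduct_self_pos he)

theorem dotProduct_mulVec_le_secondEigenvalue_mul (hA : A.IsSymm) {d : ℝ} {u : V → ℝ}
    (hu : u ≠ 0) (hAu : A *ᵥ u = d • u) (hd : ∀ f, f ⬝ᵥ A *ᵥ f ≤ d * (f ⬝ᵥ f)) {f : V → ℝ}
    (hf : u ⬝ᵥ f = 0) : f ⬝ᵥ A *ᵥ f ≤ secondEigenvalue A * (f ⬝ᵥ f) := by
  have hpos : 0 < u ⬝ᵥ u := dotProduct_self_pos hu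
  have hnonneg : 0 ≤ f ⬝ᵥ f := dotProduct_self_nonneg f
  obtain hle | hlt := le_or_gt d (secondEigenvalue A)
  · exact (hd f).trans (mul_le_mul_of_nonneg_right hle hnonneg)
  have : Nonempty V := (Function.ne_iff.1 hu).nonempty
  obtain ⟨e, -, -, he⟩ := exists_firstEigenvector hA
  have heu : e ⬝ᵥ u ≠ 0 := fun h => by
    have := he u h
    rw [hAu, dotProduct_smul, smul_eq_mul] at this
    exact hlt.not_ge (le_of_mul_le_mul_right this hpos)
  -- The span of `u` and `f` contains a vector orthogonal to `e` with nonzero `f`-component.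
  have hcomb := he ((e ⬝ᵥ u) • f - (e ⬝ᵥ f) • u) (by simp [mul_comm])
  have huAf : u ⬝ᵥ A *ᵥ f = 0 := by
    rw [dotProduct_mulVec_comm_of_isSymm hA, hAu, dotProduct_smul, dotProduct_comm, hf, smul_zero]
  have hfu : f ⬝ᵥ u = 0 := dotProduct_comm u f ▸ hf
  simp only [mulVec_sub, mulVec_smul, hAu, sub_dotProduct, dotProduct_sub, smul_dotProduct,
    dotProduct_smul, smul_eq_mul, hf, hfu, huAf] at hcomb
  refine le_of_mul_le_mul_left ?_ (sq_pos_of_ne_zero heu)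
  nlinarith [mul_nonneg (mul_nonneg (sq_nonneg (e ⬝ᵥ f)) (sub_nonneg.2 hlt.le)) hpos.le]

theorem mulVec_eq_zero_of_dotProduct_mulVec_nonpos (hA : A.IsSymm) {W : Submodule ℝ (V → ℝ)}
    (hWA : ∀ f ∈ W, A *ᵥ f ∈ W) (hW : ∀ f ∈ W, 0 ≤ f ⬝ᵥ A *ᵥ f) {f : V → ℝ} (hf : f ∈ W)
    (hfA : f ⬝ᵥ A *ᵥ f ≤ 0) : A *ᵥ f = 0 := by
  classical
  let B : LinearMap.BilinForm ℝ W := A.toBilin'.restrict W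
  have hB (x y : W) : B x y = x.1 ⬝ᵥ A *ᵥ y.1 := toBilin'_apply' A x.1 y.1
  have hcs := B.apply_mul_apply_le_of_forall_zero_le
    (fun x => by simpa only [hB] using hW x x.2) ⟨A *ᵥ f, hWA f hf⟩ ⟨f, hf⟩
  simp only [hB, hfA.antisymm (hW f hf), mul_zero,
    dotProduct_mulVec_comm_of_isSymm hA f] at hcs
  exact dotProduct_self_eq_zero.1 (mul_self_eq_zero.1 (hcs.antisymm (mul_self_nonneg _)))

theorem mulVec_eq_secondEigenvalue_smul (hA : A.IsSymm) {d : ℝ} {u : V → ℝ}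
    (hu : u ≠ 0) (hAu : A *ᵥ u = d • u) (hd : ∀ f, f ⬝ᵥ A *ᵥ f ≤ d * (f ⬝ᵥ f)) {f : V → ℝ}
    (hf : u ⬝ᵥ f = 0) (hfA : secondEigenvalue A * (f ⬝ᵥ f) ≤ f ⬝ᵥ A *ᵥ f) :
    A *ᵥ f = secondEigenvalue A • f := by
  classical
  set M := secondEigenvalue A • (1 : Matrix V V ℝ) - A with hM
  have hMf (g : V → ℝ) : M *ᵥ g = secondEigenvalue A • g - A *ᵥ g := by
    simp [hM, sub_mulVec, smul_mulVec]
  have hMsymm : M.IsSymm := (isSymm_one.smul _).sub hA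
  refine (sub_eq_zero.1 ((hMf f).symm.trans ?_)).symm
  refine mulVec_eq_zero_of_dotProduct_mulVec_nonpos hMsymm
    (W := LinearMap.ker (dotProductBilin ℝ ℝ u)) ?_ ?_ (by simpa using hf) ?_
  · intro g hg
    have hg : u ⬝ᵥ g = 0 := by simpa using hg
    have : u ⬝ᵥ M *ᵥ g = 0 := by
      rw [dotProduct_mulVec_comm_of_isSymm hMsymm, hMf, hAu, ← sub_smul, dotProduct_smul,
        dotProduct_comm, hg, smul_zero]
    simpa using this
  · intro g hg
    rw [hMf, dotProduct_sub, dotProduct_smul, smul_eq_mul, sub_nonneg]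
    exact dotProduct_mulVec_le_secondEigenvalue_mul hA hu hAu hd (by simpa using hg)
  · rw [hMf, dotProduct_sub, dotProduct_smul, smul_eq_mul]
    exact sub_nonpos.2 hfA

theorem finrank_eigenspace_le_secondEigenvalueMultiplicity [DecidableEq V] (A : Matrix V V ℝ) :
    finrank ℝ (End.eigenspace (toLin' A) (secondEigenvalue A)) ≤
      secondEigenvalueMultiplicity A := by
  refine (LinearMap.finrank_eigenspace_le _ _).trans_eq ?_
  rw [charpoly_toLin', ← Polynomial.count_roots, secondEigenvalueMultiplicity, eigenvalueList,
    ← Multiset.coe_count, Multiset.sort_eq]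
  congr!

end SymmetricMatrix

section PermutationModule

variable {K Ω : Type*} [Field K] {G : Type*} [Group G] [MulAction G Ω] {X : Submodule K (Ω → K)}

theorem exists_mem_stabilizer_invariant [Finite G] [CharZero K]
    (hX : ∀ g : G, ∀ f ∈ X, f ∘ (g • ·) ∈ X) {f : Ω → K} (hf : f ∈ X) {a : Ω} (hfa : f a ≠ 0) :
    ∃ F ∈ X, F a ≠ 0 ∧ ∀ g ∈ MulAction.stabilizer G a, F ∘ (g • ·) = F := by
  have := Fintype.ofFinite (MulAction.stabilizer G a)
  refine ⟨∑ p : MulAction.stabilizer G a, f ∘ (p.1 • ·), X.sum_mem fun p _ => hX p f hf, ?_,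
    fun g hg => ?_⟩
  · have (p : MulAction.stabilizer G a) : p.1 • a = a := p.2
    simp [Finset.sum_apply, this, hfa]
  · ext ω
    simp only [Function.comp_apply, Finset.sum_apply]
    exact Fintype.sum_equiv (Equiv.mulRight ⟨g, hg⟩) _ _ fun p => by simp [mul_smul]

variable [Fintype Ω]

variable (K Ω) in
/-- The subspace of functions with sum zero in the permutation module `K^Ω`. -/
def zeroSum : Submodule K (Ω → K) :=
  LinearMap.ker (∑ ω, LinearMap.proj ω : (Ω → K) →ₗ[K] K)

@[simp]
theorem mem_zeroSum {f : Ω → K} : f ∈ zeroSum K Ω ↔ ∑ ω, f ω = 0 := by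
  simp [zeroSum, LinearMap.sum_apply]

theorem single_sub_single_mem_zeroSum [DecidableEq Ω] (a b : Ω) :
    (Pi.single a 1 - Pi.single b 1 : Ω → K) ∈ zeroSum K Ω := by
  simp

theorem zeroSum_ne_bot [Nontrivial Ω] : zeroSum K Ω ≠ ⊥ := by
  classical
  obtain ⟨a, b, hab⟩ := exists_pair_ne Ω
  refine (Submodule.ne_bot_iff _).2 ⟨_, single_sub_single_mem_zeroSum a b, fun h => ?_⟩
  simpa [hab] using congrFun h a

theorem finrank_zeroSum_add_one [Nonempty Ω] :
    finrank K (zeroSum K Ω) + 1 = Fintype.card Ω := by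
  classical
  have hne : (∑ ω, LinearMap.proj ω : Dual K (Ω → K)) ≠ 0 := fun h => by
    simpa [LinearMap.sum_apply] using
      LinearMap.congr_fun h (Pi.single (Classical.arbitrary Ω) (1 : K))
  rw [zeroSum, Dual.finrank_ker_add_one_of_ne_zero hne, finrank_fintype_fun_eq_card]

theorem zeroSum_le_of_single_sub_single_mem [DecidableEq Ω] {a : Ω}
    (hX : ∀ b, (Pi.single b 1 - Pi.single a 1 : Ω → K) ∈ X) : zeroSum K Ω ≤ X := by
  intro f hf
  have : f = ∑ b, f b • (Pi.single b 1 - Pi.single a 1 : Ω → K) := by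
    simp only [smul_sub, Finset.sum_sub_distrib, ← Finset.sum_smul, mem_zeroSum.1 hf, zero_smul,
      sub_zero]
    exact pi_eq_sum_univ' f
  rw [this]
  exact X.sum_mem fun b _ => X.smul_mem _ (hX b)

theorem exists_eq_const_add_single_of_stabilizer_invariant [CharZero K] [DecidableEq Ω]
    [h2 : MulAction.IsMultiplyPretransitive G Ω 2] {F : Ω → K} (hF : F ∈ zeroSum K Ω) {a : Ω}
    (hFa : F a ≠ 0) (hinv : ∀ g ∈ MulAction.stabilizer G a, F ∘ (g • ·) = F) :
    ∃ c r : K, r ≠ 0 ∧ F = Function.const Ω c + Pi.single a r := by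
  have hne : ∃ b, b ≠ a := by
    by_contra! h
    have : Unique Ω := ⟨⟨a⟩, h⟩
    exact hFa (by simpa [h default] using mem_zeroSum.1 hF)
  obtain ⟨b, hb⟩ := hne
  have hconst (ω : Ω) (hω : ω ≠ a) : F ω = F b := by
    obtain ⟨g, hga, hgb⟩ := MulAction.is_two_pretransitive_iff.1 h2 hb.symm hω.symm
    rw [← hgb]
    exact congrFun (hinv g hga) b
  refine ⟨F b, F a - F b, fun h => hFa ?_, ?_⟩
  · have hall (ω : Ω) : F ω = F a := by
      obtain rfl | hω := eq_or_ne ω a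
      · rfl
      · rw [hconst ω hω, sub_eq_zero.1 h]
    simpa [hall, Fintype.card_ne_zero, show Nonempty Ω from ⟨a⟩] using mem_zeroSum.1 hF
  · ext ω
    obtain rfl | hω := eq_or_ne ω a
    · simp
    · simp [hω, hconst]

theorem eq_zeroSum_of_isMultiplyPretransitive_two [Finite G] [CharZero K]
    [MulAction.IsMultiplyPretransitive G Ω 2] (hX : ∀ g : G, ∀ f ∈ X, f ∘ (g • ·) ∈ X)
    (hle : X ≤ zeroSum K Ω) (hbot : X ≠ ⊥) : X = zeroSum K Ω := by
  classical
  obtain ⟨f, hf, hf0⟩ := (Submodule.ne_bot_iff X).1 hbot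
  obtain ⟨a, hfa⟩ := Function.ne_iff.1 hf0
  obtain ⟨F, hF, hFa, hinv⟩ := exists_mem_stabilizer_invariant hX hf hfa
  obtain ⟨c, r, hr, hFeq⟩ :=
    exists_eq_const_add_single_of_stabilizer_invariant (hle hF) hFa hinv
  refine hle.antisymm (zeroSum_le_of_single_sub_single_mem (a := a) fun b => ?_)
  have : MulAction.IsPretransitive G Ω := MulAction.isPretransitive_of_is_two_pretransitive
  obtain ⟨g, rfl⟩ := MulAction.exists_smul_eq G a b
  have hdiff : (Pi.single (g • a) 1 - Pi.single a 1 : Ω → K) =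
      r⁻¹ • (F ∘ (g⁻¹ • ·) - F) := by
    ext ω
    simp [hFeq, Pi.single_apply, inv_smul_eq_iff, mul_sub, hr]
  rw [hdiff]
  exact X.smul_mem _ (X.sub_mem (hX g⁻¹ F hF) hF)

end PermutationModule

section Cosets

variable {G : Type*} [Group G] {P : Subgroup G}

theorem exists_mul_mul_eq_of_card_doubleCoset_eq_two
    (hcosets : Nat.card (DoubleCoset.Quotient (P : Set G) (P : Set G)) = 2) {g h : G}
    (hg : g ∉ P) (hh : h ∉ P) : ∃ p ∈ P, ∃ q ∈ P, h = p * g * q := by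
  have hne (x : G) (hx : x ∉ P) : DoubleCoset.mk P P x ≠ DoubleCoset.mk P P 1 := fun h => by
    obtain ⟨p, hp, q, hq, hpq⟩ := (DoubleCoset.eq P P 1 x).1 h.symm
    exact hx (by simpa [hpq] using mul_mem hp hq)
  exact (DoubleCoset.eq P P g h).1
    (((Nat.card_eq_two_iff' _).1 hcosets).unique (hne g hg) (hne h hh))

theorem isMultiplyPretransitive_two_quotient_of_card_doubleCoset_eq_two
    (hcosets : Nat.card (DoubleCoset.Quotient (P : Set G) (P : Set G)) = 2) :
    MulAction.IsMultiplyPretransitive G (G ⧸ P) 2 := by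
  refine MulAction.is_two_pretransitive_iff.2 fun {a b c d} => ?_
  induction a using QuotientGroup.induction_on with | H x
  induction b using QuotientGroup.induction_on with | H y
  induction c using QuotientGroup.induction_on with | H x'
  induction d using QuotientGroup.induction_on with | H y'
  simp only [ne_eq, QuotientGroup.eq, MulAction.Quotient.smul_coe, smul_eq_mul]
  intro hxy hxy'
  obtain ⟨p, hp, q, hq, hpq⟩ := exists_mul_mul_eq_of_card_doubleCoset_eq_two hcosets hxy hxy'
  refine ⟨x' * p * x⁻¹, by simpa using hp, ?_⟩
  have : y' = x' * (p * (x⁻¹ * y) * q) := by rw [← hpq, mul_inv_cancel_left]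
  simpa [this, mul_assoc] using hq

theorem nontrivial_quotient_of_card_doubleCoset_eq_two
    (hcosets : Nat.card (DoubleCoset.Quotient (P : Set G) (P : Set G)) = 2) :
    Nontrivial (G ⧸ P) := by
  rw [QuotientGroup.nontrivial_iff]
  rintro rfl
  obtain ⟨y, hy, -⟩ := (Nat.card_eq_two_iff' (DoubleCoset.mk ⊤ ⊤ (1 : G))).1 hcosets
  induction y using Quotient.inductionOn' with | h g
  exact hy ((DoubleCoset.eq ⊤ ⊤ g 1).2 ⟨g⁻¹, trivial, 1, trivial, by simp⟩)

variable [Fintype G] {K : Type*} [Field K]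

variable (K P) in
open Classical in
/-- The pushforward of functions along `G → G ⧸ P`: the sum of a function over each left coset
of `P`. -/
noncomputable def cosetSum : (G → K) →ₗ[K] (G ⧸ P → K) where
  toFun f q := ∑ x with QuotientGroup.mk x = q, f x
  map_add' _ _ := by ext; simp [Finset.sum_add_distrib]
  map_smul' _ _ := by ext; simp [Finset.mul_sum]

theorem cosetSum_mk [Fintype P] (f : G → K) (x : G) :
    cosetSum P K f x = ∑ p : P, f (x * p) := by
  classical
  symm
  refine Finset.sum_bij' (fun p _ => x * p) (fun y hy => ⟨x⁻¹ * y, ?_⟩) ?_ ?_ ?_ ?_ ?_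
  · exact QuotientGroup.eq.1 (Finset.mem_filter.1 hy).2.symm
  all_goals simp

theorem sum_cosetSum [Fintype (G ⧸ P)] (f : G → K) : ∑ q, cosetSum P K f q = ∑ x, f x := by
  classical
  simpa [cosetSum] using Finset.sum_fiberwise Finset.univ (QuotientGroup.mk : G → G ⧸ P) f

theorem cosetSum_comp_mul_left (f : G → K) (g : G) :
    cosetSum P K (f ∘ (g * ·)) = cosetSum P K f ∘ (g • ·) := by
  have := Fintype.ofFinite P
  ext q
  induction q using QuotientGroup.induction_on with | H x
  simp [cosetSum_mk, mul_assoc]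

theorem cosetSum_comp_mk (φ : G ⧸ P → K) :
    cosetSum P K (φ ∘ QuotientGroup.mk) = (Nat.card P : K) • φ := by
  have := Fintype.ofFinite P
  ext q
  induction q using QuotientGroup.induction_on with | H x
  simp [cosetSum_mk]

theorem sum_comp_mk [Fintype (G ⧸ P)] (φ : G ⧸ P → K) :
    ∑ x : G, φ x = Nat.card P * ∑ q, φ q := by
  rw [← Function.comp_def, ← sum_cosetSum (P := P), cosetSum_comp_mk]
  simp [Finset.mul_sum]

theorem index_le_finrank_add_one [CharZero K]
    (hcosets : Nat.card (DoubleCoset.Quotient (P : Set G) (P : Set G)) = 2)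
    {W : Submodule K (G → K)} (hW : ∀ g : G, ∀ f ∈ W, f ∘ (g * ·) ∈ W) (hle : W ≤ zeroSum K G)
    {f : G → K} (hf : f ∈ W) (hne : cosetSum P K f ≠ 0) : P.index ≤ finrank K W + 1 := by
  have := Fintype.ofFinite (G ⧸ P)
  have := isMultiplyPretransitive_two_quotient_of_card_doubleCoset_eq_two hcosets
  have hmap : W.map (cosetSum P K) = zeroSum K (G ⧸ P) := by
    refine eq_zeroSum_of_isMultiplyPretransitive_two (G := G) ?_ ?_ ?_
    · rintro g _ ⟨u, hu, rfl⟩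
      exact ⟨_, hW g u hu, cosetSum_comp_mul_left u g⟩
    · rintro _ ⟨u, hu, rfl⟩
      rw [mem_zeroSum, sum_cosetSum, mem_zeroSum.1 (hle hu)]
    · exact (Submodule.ne_bot_iff _).2 ⟨_, Submodule.mem_map_of_mem hf, hne⟩
  calc P.index = finrank K (zeroSum K (G ⧸ P)) + 1 := by
        rw [finrank_zeroSum_add_one, Subgroup.index, Nat.card_eq_fintype_card]
    _ ≤ finrank K W + 1 := by
        rw [← hmap]
        gcongr
        exact Submodule.finrank_map_le _ _

end Cosets

section Cayley

variable {G : Type*} [Group G] {S T U : Set G}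

theorem cayleyAdjMatrix_union (h : Disjoint S U) :
    cayleyAdjMatrix (S ∪ U) = cayleyAdjMatrix S + cayleyAdjMatrix U := by
  ext x y
  by_cases hS : x⁻¹ * y ∈ S
  · simp [cayleyAdjMatrix, hS, h.notMem_of_mem_left hS]
  · by_cases hU : x⁻¹ * y ∈ U <;> simp [cayleyAdjMatrix, hS, hU]

theorem inv_preimage_subgroup_eq {P : Subgroup G} (hS : S⁻¹ = S) :
    {s : P | (s : G) ∈ S}⁻¹ = {s : P | (s : G) ∈ S} := by
  ext s
  simp [← Set.mem_inv (s := S), hS]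

variable [Fintype G]

theorem cayleyAdjMatrix_mulVec_apply [Fintype T] (f : G → ℝ) (g : G) :
    (cayleyAdjMatrix T *ᵥ f) g = ∑ s : T, f (g * s) := by
  classical
  simp only [mulVec, dotProduct, cayleyAdjMatrix, of_apply, ite_mul, one_mul, zero_mul]
  rw [← Equiv.sum_comp (Equiv.mulLeft g)]
  simp only [Equiv.coe_mulLeft, inv_mul_cancel_left]
  rw [← Finset.sum_filter]
  exact Finset.sum_subtype _ (by simp) _

theorem cayleyAdjMatrix_mulVec_comp_mul_left (f : G → ℝ) (g : G) :
    cayleyAdjMatrix T *ᵥ (f ∘ (g * ·)) = (cayleyAdjMatrix T *ᵥ f) ∘ (g * ·) := by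
  have := Fintype.ofFinite T
  ext x
  simp [cayleyAdjMatrix_mulVec_apply, mul_assoc]

theorem comp_mul_left_mem_eigenspace_cayleyAdjMatrix [DecidableEq G] {μ : ℝ} {f : G → ℝ}
    (hf : f ∈ End.eigenspace (toLin' (cayleyAdjMatrix T)) μ) (g : G) :
    f ∘ (g * ·) ∈ End.eigenspace (toLin' (cayleyAdjMatrix T)) μ := by
  rw [End.mem_eigenspace_iff, toLin'_apply] at hf ⊢
  rw [cayleyAdjMatrix_mulVec_comp_mul_left, hf]
  rfl

theorem cayleyAdjMatrix_mulVec_eq_ncard_smul {f : G → ℝ} (hf : ∀ g, ∀ s ∈ T, f (g * s) = f g) :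
    cayleyAdjMatrix T *ᵥ f = (T.ncard : ℝ) • f := by
  have := Fintype.ofFinite T
  ext g
  have (s : T) : f (g * s) = f g := hf g s s.2
  simp [cayleyAdjMatrix_mulVec_apply, this]

theorem abs_dotProduct_comp_perm_le {V : Type*} [Fintype V] (f : V → ℝ) (σ : Equiv.Perm V) :
    |f ⬝ᵥ f ∘ σ| ≤ f ⬝ᵥ f := by
  refine abs_le_of_sq_le_sq ?_ (dotProduct_self_nonneg f)
  calc (f ⬝ᵥ f ∘ σ) ^ 2 ≤ (∑ v, f v ^ 2) * ∑ v, f (σ v) ^ 2 :=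
        Finset.sum_mul_sq_le_sq_mul_sq _ _ _
    _ = (f ⬝ᵥ f) ^ 2 := by
        rw [Equiv.sum_comp σ (f · ^ 2), sq (f ⬝ᵥ f)]
        simp only [dotProduct, sq]

theorem abs_dotProduct_cayleyAdjMatrix_mulVec_le (f : G → ℝ) :
    |f ⬝ᵥ cayleyAdjMatrix T *ᵥ f| ≤ T.ncard * (f ⬝ᵥ f) := by
  have := Fintype.ofFinite T
  have hsum : cayleyAdjMatrix T *ᵥ f = ∑ s : T, f ∘ Equiv.mulRight (s : G) := by
    ext g
    simp [cayleyAdjMatrix_mulVec_apply]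
  rw [hsum, dotProduct_sum]
  calc |∑ s : T, f ⬝ᵥ f ∘ Equiv.mulRight (s : G)|
      ≤ ∑ s : T, |f ⬝ᵥ f ∘ Equiv.mulRight (s : G)| := Finset.abs_sum_le_sum_abs _ _
    _ ≤ ∑ _s : T, f ⬝ᵥ f := Finset.sum_le_sum fun s _ => abs_dotProduct_comp_perm_le f _
    _ = T.ncard * (f ⬝ᵥ f) := by simp

theorem dotProduct_cayleyAdjMatrix_mulVec_le (f : G → ℝ) :
    f ⬝ᵥ cayleyAdjMatrix T *ᵥ f ≤ T.ncard * (f ⬝ᵥ f) :=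
  (abs_le.1 (abs_dotProduct_cayleyAdjMatrix_mulVec_le f)).2

omit [Fintype G] in
theorem firstEigenvalue_cayleyAdjMatrix_le [Finite G] (hT : T⁻¹ = T) :
    firstEigenvalue (cayleyAdjMatrix T) ≤ T.ncard :=
  have := Fintype.ofFinite G
  firstEigenvalue_le_of_dotProduct_mulVec_le (cayleyAdjMatrix_isSymm hT)
    dotProduct_cayleyAdjMatrix_mulVec_le

theorem dotProduct_cayleyAdjMatrix_mulVec_le_secondEigenvalue_mul (hT : T⁻¹ = T) {f : G → ℝ}
    (hf : f ∈ zeroSum ℝ G) :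
    f ⬝ᵥ cayleyAdjMatrix T *ᵥ f ≤ secondEigenvalue (cayleyAdjMatrix T) * (f ⬝ᵥ f) :=
  dotProduct_mulVec_le_secondEigenvalue_mul (cayleyAdjMatrix_isSymm hT) one_ne_zero
    (cayleyAdjMatrix_mulVec_eq_ncard_smul fun _ _ _ => rfl)
    dotProduct_cayleyAdjMatrix_mulVec_le (by rwa [one_dotProduct, ← mem_zeroSum])

theorem cayleyAdjMatrix_mulVec_eq_secondEigenvalue_smul (hT : T⁻¹ = T) {f : G → ℝ}
    (hf : f ∈ zeroSum ℝ G)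
    (hle : secondEigenvalue (cayleyAdjMatrix T) * (f ⬝ᵥ f) ≤ f ⬝ᵥ cayleyAdjMatrix T *ᵥ f) :
    cayleyAdjMatrix T *ᵥ f = secondEigenvalue (cayleyAdjMatrix T) • f :=
  mulVec_eq_secondEigenvalue_smul (cayleyAdjMatrix_isSymm hT) one_ne_zero
    (cayleyAdjMatrix_mulVec_eq_ncard_smul fun _ _ _ => rfl)
    dotProduct_cayleyAdjMatrix_mulVec_le (by rwa [one_dotProduct, ← mem_zeroSum]) hle

variable {P : Subgroup G}

theorem cayleyAdjMatrix_subgroup_mulVec [Fintype P] (hSP : S ⊆ P) (f : G → ℝ) (x : G) :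
    cayleyAdjMatrix {s : P | (s : G) ∈ S} *ᵥ (fun p : P => f (x * p)) =
      fun p : P => (cayleyAdjMatrix S *ᵥ f) (x * p) := by
  have := Fintype.ofFinite S
  let e : {s : P | (s : G) ∈ S} ≃ S := Equiv.subtypeSubtypeEquivSubtype fun hs => hSP hs
  have := Fintype.ofEquiv _ e.symm
  ext p
  rw [cayleyAdjMatrix_mulVec_apply, cayleyAdjMatrix_mulVec_apply]
  exact Fintype.sum_equiv e _ _ fun s => congrArg f (mul_assoc x p s).symm

theorem sum_dotProduct_coset [Fintype P] (f h : G → ℝ) :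
    ∑ x : G, (fun p : P => f (x * p)) ⬝ᵥ (fun p : P => h (x * p)) = Nat.card P * (f ⬝ᵥ h) := by
  have (p : P) : ∑ x, f (x * p) * h (x * p) = f ⬝ᵥ h :=
    Equiv.sum_comp (Equiv.mulRight (p : G)) fun x => f x * h x
  simp only [dotProduct] at this ⊢
  rw [Finset.sum_comm]
  simp [this]

theorem dotProduct_cayleyAdjMatrix_mulVec_le_of_cosetSum_eq_zero (hS : S⁻¹ = S) (hSP : S ⊆ P)
    {f : G → ℝ} (hf : cosetSum P ℝ f = 0) :
    f ⬝ᵥ cayleyAdjMatrix S *ᵥ f ≤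
      secondEigenvalue (cayleyAdjMatrix {s : P | (s : G) ∈ S}) * (f ⬝ᵥ f) := by
  have := Fintype.ofFinite P
  have hcoset (x : G) := dotProduct_cayleyAdjMatrix_mulVec_le_secondEigenvalue_mul
    (inv_preimage_subgroup_eq (P := P) hS) (f := fun p => f (x * p))
    (by rw [mem_zeroSum, ← cosetSum_mk, hf, Pi.zero_apply])
  have hsum := Finset.sum_le_sum fun x (_ : x ∈ Finset.univ) => hcoset x
  simp only [cayleyAdjMatrix_subgroup_mulVec hSP, ← Finset.mul_sum, sum_dotProduct_coset,
    mul_left_comm _ (Nat.card P : ℝ)] at hsum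
  exact le_of_mul_le_mul_left hsum (mod_cast Nat.card_pos)

omit [Fintype G] in
theorem secondEigenvalue_cayleyAdjMatrix_subgroup_le [Finite P] (hS : S⁻¹ = S) (hSP : S ⊆ P) {d : ℝ}
    (hgap : d ≤ spectralGap (cayleyAdjMatrix {s : P | (s : G) ∈ S})) :
    secondEigenvalue (cayleyAdjMatrix {s : P | (s : G) ∈ S}) ≤ S.ncard - d := by
  have hfirst := firstEigenvalue_cayleyAdjMatrix_le (inv_preimage_subgroup_eq (P := P) hS)
  have hncard : {s : P | (s : G) ∈ S}.ncard = S.ncard :=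
    Set.ncard_preimage_of_injective_subset_range Subtype.val_injective (by simpa using hSP)
  rw [hncard] at hfirst
  rw [spectralGap] at hgap
  linarith

theorem dotProduct_cayleyAdjMatrix_union_mulVec_le_of_cosetSum_eq_zero (hS : S⁻¹ = S) (hSP : S ⊆ P)
    (hSU : Disjoint S U)
    (hgap : 2 * (U.ncard : ℝ) ≤ spectralGap (cayleyAdjMatrix {s : P | (s : G) ∈ S}))
    {f : G → ℝ} (hf : cosetSum P ℝ f = 0) :
    f ⬝ᵥ cayleyAdjMatrix (S ∪ U) *ᵥ f ≤ (S.ncard - U.ncard) * (f ⬝ᵥ f) := by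
  have hnonneg : 0 ≤ f ⬝ᵥ f := dotProduct_self_nonneg f
  rw [cayleyAdjMatrix_union hSU, add_mulVec, dotProduct_add]
  calc f ⬝ᵥ cayleyAdjMatrix S *ᵥ f + f ⬝ᵥ cayleyAdjMatrix U *ᵥ f
      ≤ (S.ncard - 2 * U.ncard) * (f ⬝ᵥ f) + U.ncard * (f ⬝ᵥ f) := by
        gcongr
        · refine (dotProduct_cayleyAdjMatrix_mulVec_le_of_cosetSum_eq_zero hS hSP hf).trans ?_
          gcongr
          exact secondEigenvalue_cayleyAdjMatrix_subgroup_le hS hSP hgap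
        · exact dotProduct_cayleyAdjMatrix_mulVec_le f
    _ = (S.ncard - U.ncard) * (f ⬝ᵥ f) := by ring

theorem le_dotProduct_cayleyAdjMatrix_union_mulVec_comp_mk (hSP : S ⊆ P)
    (hSU : Disjoint S U) (φ : G ⧸ P → ℝ) :
    (S.ncard - U.ncard) * (φ ∘ QuotientGroup.mk ⬝ᵥ φ ∘ QuotientGroup.mk) ≤
      φ ∘ QuotientGroup.mk ⬝ᵥ cayleyAdjMatrix (S ∪ U) *ᵥ (φ ∘ QuotientGroup.mk) := by
  have hS : cayleyAdjMatrix S *ᵥ (φ ∘ QuotientGroup.mk) =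
      (S.ncard : ℝ) • (φ ∘ QuotientGroup.mk) :=
    cayleyAdjMatrix_mulVec_eq_ncard_smul fun g s hs =>
      congrArg φ (QuotientGroup.mk_mul_of_mem g (hSP hs))
  have hU := (abs_le.1 (abs_dotProduct_cayleyAdjMatrix_mulVec_le (T := U)
    (φ ∘ QuotientGroup.mk (s := P)))).1
  rw [cayleyAdjMatrix_union hSU, add_mulVec, dotProduct_add, hS, dotProduct_smul, smul_eq_mul,
    sub_mul]
  linarith

theorem exists_zeroSum_secondEigenvector_cosetSum_ne_zero [Nontrivial (G ⧸ P)] (hS : S⁻¹ = S)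
    (hU : U⁻¹ = U) (hSP : S ⊆ P) (hSU : Disjoint S U)
    (hgap : 2 * (U.ncard : ℝ) ≤ spectralGap (cayleyAdjMatrix {s : P | (s : G) ∈ S})) :
    ∃ f ∈ zeroSum ℝ G, cosetSum P ℝ f ≠ 0 ∧
      cayleyAdjMatrix (S ∪ U) *ᵥ f = secondEigenvalue (cayleyAdjMatrix (S ∪ U)) • f := by
  have hSUinv : (S ∪ U)⁻¹ = S ∪ U := by rw [Set.union_inv, hS, hU]
  obtain hle | hlt := le_or_gt (secondEigenvalue (cayleyAdjMatrix (S ∪ U))) (S.ncard - U.ncard)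
  · have := Fintype.ofFinite (G ⧸ P)
    obtain ⟨φ, hφ, hφ0⟩ := (Submodule.ne_bot_iff _).1 (zeroSum_ne_bot (K := ℝ) (Ω := G ⧸ P))
    have hsum : φ ∘ QuotientGroup.mk ∈ zeroSum ℝ G := by
      simp only [mem_zeroSum, Function.comp_apply, sum_comp_mk, mem_zeroSum.1 hφ, mul_zero]
    refine ⟨φ ∘ QuotientGroup.mk, hsum, ?_, ?_⟩
    · rw [cosetSum_comp_mk]
      exact smul_ne_zero (mod_cast Nat.card_pos.ne') hφ0
    · refine cayleyAdjMatrix_mulVec_eq_secondEigenvalue_smul hSUinv hsum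
        (le_trans ?_ (le_dotProduct_cayleyAdjMatrix_union_mulVec_comp_mk hSP hSU φ))
      exact mul_le_mul_of_nonneg_right hle (dotProduct_self_nonneg _)
  · have : Nontrivial G := (QuotientGroup.mk_surjective (s := P)).nontrivial
    obtain ⟨f, hf0, hf, hfle⟩ := exists_dotProduct_eq_zero_secondEigenvalue_mul_le
      (cayleyAdjMatrix_isSymm hSUinv) 1
    have hsum : f ∈ zeroSum ℝ G := by rwa [mem_zeroSum, ← one_dotProduct]
    refine ⟨f, hsum, fun h => hlt.not_ge ?_,
      cayleyAdjMatrix_mulVec_eq_secondEigenvalue_smul hSUinv hsum hfle⟩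
    have hle := dotProduct_cayleyAdjMatrix_union_mulVec_le_of_cosetSum_eq_zero hS hSP hSU hgap h
    exact le_of_mul_le_mul_right (hfle.trans hle) (dotProduct_self_pos hf0)

end Cayley

theorem theorem2p1_general {Γ : Type*} [Group Γ] [Finite Γ] {S U : Set Γ} (hS : S⁻¹ = S)
    (hU : U⁻¹ = U) {P : Subgroup Γ} (hSP : S ⊆ P) (hSU : Disjoint S U)
    (hgap : 2 * (U.ncard : ℝ) ≤ spectralGap (cayleyAdjMatrix {s : P | (s : Γ) ∈ S}))
    (hcosets : Nat.card (DoubleCoset.Quotient (P : Set Γ) (P : Set Γ)) = 2) :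
    (Nat.card Γ : ℝ) / (Nat.card P : ℝ) - 1 ≤
      (secondEigenvalueMultiplicity (cayleyAdjMatrix (S ∪ U)) : ℝ) := by
  classical
  have := Fintype.ofFinite Γ
  have := nontrivial_quotient_of_card_doubleCoset_eq_two hcosets
  obtain ⟨f, hf, hfP, hAf⟩ := exists_zeroSum_secondEigenvector_cosetSum_ne_zero hS hU hSP hSU hgap
  set A := cayleyAdjMatrix (S ∪ U)
  let E := End.eigenspace (toLin' A) (secondEigenvalue A)
  have htrans (g : Γ) : ∀ h ∈ E ⊓ zeroSum ℝ Γ, h ∘ (g * ·) ∈ E ⊓ zeroSum ℝ Γ := fun h hh =>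
    ⟨comp_mul_left_mem_eigenspace_cayleyAdjMatrix hh.1 g,
      mem_zeroSum.2 ((Equiv.sum_comp (Equiv.mulLeft g) h).trans (mem_zeroSum.1 hh.2))⟩
  have hindex : P.index ≤ secondEigenvalueMultiplicity A + 1 :=
    calc P.index ≤ finrank ℝ ↥(E ⊓ zeroSum ℝ Γ) + 1 :=
          index_le_finrank_add_one hcosets htrans inf_le_right
            ⟨End.mem_eigenspace_iff.2 hAf, hf⟩ hfP
      _ ≤ finrank ℝ E + 1 := by gcongr; exact Submodule.finrank_mono inf_le_left
      _ ≤ secondEigenvalueMultiplicity A + 1 := by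
          gcongr
          exact finrank_eigenspace_le_secondEigenvalueMultiplicity A
  rw [sub_le_iff_le_add, ← P.card_mul_index, Nat.cast_mul,
    mul_div_cancel_left₀ _ (mod_cast Nat.card_pos.ne')]
  exact_mod_cast hindex

theorem theorem2p1 {Γ : Type*} [Group Γ] [Finite Γ] (S : Set Γ) (hS : S⁻¹ = S)
    (P : Subgroup Γ) (hP : P = Subgroup.closure S)
    (hgap : 4 ≤ spectralGap (cayleyAdjMatrix {s : P | (s : Γ) ∈ S}))
    (hcosets : Nat.card (DoubleCoset.Quotient (P : Set Γ) (P : Set Γ)) = 2)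
    (t : Γ) (ht : t ∉ P) (htinv : t ≠ t⁻¹) :
    (Nat.card Γ : ℝ) / (Nat.card P : ℝ) - 1 ≤
      (secondEigenvalueMultiplicity (cayleyAdjMatrix (S ∪ {t, t⁻¹})) : ℝ) := by
  have hSP : S ⊆ P := hP ▸ Subgroup.subset_closure
  have hpair : (({t, t⁻¹} : Set Γ).ncard : ℝ) ≤ 2 := by
    simpa using (Nat.cast_le (α := ℝ)).2 (Set.ncard_insert_le t {t⁻¹})
  have hdisj : Disjoint S {t, t⁻¹} :=
    Set.disjoint_of_subset_left hSP (by simp [ht])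
  exact theorem2p1_general hS (by simp [Set.pair_comm]) hSP hdisj (by linarith) hcosets
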